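/- Let $p$ be a positive real number that is not an even integer. Let $\ell_p$ be the real vector space of all real sequences $x=(x_j)_{j\in\mathbb{N}}$ with $\sum_j|x_j|^p<\infty$, equipped with $\|x\|_p=\bigl(\sum_j|x_j|^p\bigr)^{1/p}$ (a norm if $p\ge 1$, a quasi-norm if $0<p<1$), and let $\ell_2^2$ be $\mathbb{R}^2$ with the Euclidean norm $\|\cdot\|_2$. Then $\ell_2^2$ is not isometric to a subspace of $\ell_p$; that is, there are no linear subspace $X\subseteq\ell_p$ and linear bijection $e:\ell_2^2\to X$ such that $\|e(u)\|_p=\|u\|_2$ for all $u\in\ell_2^2$. -/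

import Mathlib

/-!
A linear isometric embedding `e` is determined by the plane vectors `z j = (e(e₀) j, e(e₁) j)`, and
evaluating it at `(cos θ, sin θ)` gives `∑ j, ‖z j‖ ^ p * |cos (θ - arg (z j))| ^ p = 1` for all `θ`:
the convolution of `|cos| ^ p` with the atomic measure `∑ j, ‖z j‖ ^ p • δ (arg (z j))` is constant.

Integration by parts yields the recurrence `cosPowCoeff_succ` for the Fourier coefficients of
`|cos| ^ p` at even frequencies, so none of them vanishes when `p` is not an even integer
(`cosPowCoeff_ne_zero`). Hence the measure has no Fourier coefficients at nonzero even frequencies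
(`hasSum_mul_cos_eq_zero`). Modulo `π` such a measure is a multiple of Lebesgue measure; being
atomic, it is zero (`eq_zero_of_hasSum_mul_cos_eq_zero`, a quantitative form of Wiener's lemma).
Then the sum above is `0`, not `1`.
-/

open MeasureTheory Real

/-- The Fourier coefficient of `|cos|^p` (a `π`-periodic function) at the frequency `2k`. -/
noncomputable def cosPowCoeff (p : ℝ) (k : ℕ) : ℝ :=
  ∫ θ in -(π / 2)..π / 2, |cos θ| ^ p * cos (2 * k * θ)

theorem continuous_abs_cos_rpow {p : ℝ} (hp : 0 < p) : Continuous fun θ : ℝ => |cos θ| ^ p :=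
  (continuous_abs.comp continuous_cos).rpow_const fun _ => Or.inr hp.le

/-- Obtained by integrating the derivative of `cos θ ^ (p + 1) * sin ((2k + 1) θ)`, which vanishes
at both ends of the interval. -/
theorem cosPowCoeff_succ {p : ℝ} (hp : 0 < p) (k : ℕ) :
    (p + 2 * k + 2) * cosPowCoeff p (k + 1) = (p - 2 * k) * cosPowCoeff p k := by
  have hcont (n : ℕ) : Continuous fun θ : ℝ => |cos θ| ^ p * cos (2 * n * θ) :=
    (continuous_abs_cos_rpow hp).mul (by fun_prop)
  have hint (n : ℕ) : IntervalIntegrable (fun θ : ℝ => |cos θ| ^ p * cos (2 * n * θ)) volume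
      (-(π / 2)) (π / 2) := (hcont n).intervalIntegrable _ _
  have hderiv : ∀ θ ∈ Set.uIcc (-(π / 2)) (π / 2),
      HasDerivAt (fun θ : ℝ => cos θ ^ (p + 1) * sin ((2 * k + 1) * θ))
        ((p + 2 * k + 2) / 2 * (|cos θ| ^ p * cos (2 * (k + 1 : ℕ) * θ))
          - (p - 2 * k) / 2 * (|cos θ| ^ p * cos (2 * k * θ))) θ := by
    intro θ hθ
    rw [Set.uIcc_of_le (by linarith [pi_pos])] at hθ
    have h0 : 0 ≤ cos θ := cos_nonneg_of_mem_Icc hθ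
    have h1 := (hasDerivAt_cos θ).rpow_const (p := p + 1) (Or.inr (by linarith))
    have h2 : HasDerivAt (fun θ : ℝ => sin ((2 * k + 1) * θ))
        (cos ((2 * k + 1) * θ) * ((2 * k + 1) * 1)) θ :=
      ((hasDerivAt_id θ).const_mul (2 * (k : ℝ) + 1)).sin
    refine (h1.mul h2).congr_deriv ?_
    have e1 : cos (2 * (k + 1 : ℕ) * θ) =
        cos ((2 * k + 1) * θ) * cos θ - sin ((2 * k + 1) * θ) * sin θ := by
      rw [← cos_add]; push_cast; ring_nf
    have e2 : cos (2 * k * θ) =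
        cos ((2 * k + 1) * θ) * cos θ + sin ((2 * k + 1) * θ) * sin θ := by
      rw [← cos_sub]; ring_nf
    rw [abs_of_nonneg h0, e1, e2, rpow_add_one' h0 (by linarith), add_sub_cancel_right]
    ring
  have hI := intervalIntegral.integral_eq_sub_of_hasDerivAt hderiv
    (((hint _).const_mul _).sub ((hint _).const_mul _))
  rw [intervalIntegral.integral_sub ((hint _).const_mul _) ((hint _).const_mul _),
    intervalIntegral.integral_const_mul, intervalIntegral.integral_const_mul, cos_neg, cos_pi_div_two,
    zero_rpow (by linarith)] at hI
  unfold cosPowCoeff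
  linarith

theorem cosPowCoeff_ne_zero {p : ℝ} (hp : 0 < p) (hp' : ∀ k : ℕ, p ≠ 2 * (k : ℝ)) (k : ℕ) :
    cosPowCoeff p k ≠ 0 := by
  induction k with
  | zero =>
    refine ne_of_gt (intervalIntegral.intervalIntegral_pos_of_pos_on ?_ ?_ (by linarith [pi_pos]))
    · exact ((continuous_abs_cos_rpow hp).mul (by fun_prop)).intervalIntegrable _ _
    · intro θ hθ
      have := cos_pos_of_mem_Ioo hθ
      simp only [Nat.cast_zero, mul_zero, zero_mul, cos_zero, mul_one]
      positivity
  | succ k ih =>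
    intro h
    have := cosPowCoeff_succ hp k
    rw [h, mul_zero] at this
    exact mul_ne_zero (sub_ne_zero.2 (hp' k)) ih this.symm

/-- The even function `|cos|^p` acts by convolution on `cos (2k ·)` as a scalar. -/
theorem integral_abs_cos_sub_rpow_mul_cos {p : ℝ} (hp : 0 < p) (k : ℕ) (t φ : ℝ) :
    ∫ θ in -(π / 2)..π / 2, |cos (θ - t)| ^ p * cos (2 * k * (θ - φ)) =
      cosPowCoeff p k * cos (2 * k * (t - φ)) := by
  set g : ℝ → ℝ := fun θ => |cos θ| ^ p * cos (2 * k * (θ + t - φ)) with hg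
  have hper : Function.Periodic g π := by
    intro θ
    have : 2 * k * (θ + π + t - φ) = 2 * k * (θ + t - φ) + k * (2 * π) := by ring
    simp only [hg, cos_add_pi, abs_neg, this, cos_add_nat_mul_two_pi]
  have h1 : ∫ θ in -(π / 2)..π / 2, |cos (θ - t)| ^ p * cos (2 * k * (θ - φ)) =
      ∫ θ in -(π / 2)..π / 2, g θ := by
    have := intervalIntegral.integral_comp_sub_right (a := -(π / 2)) (b := π / 2) g t
    simp only [hg, sub_add_cancel] at this
    rw [this]
    have h := hper.intervalIntegral_add_eq (-(π / 2) - t) (-(π / 2))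
    convert h using 2 <;> ring
  have hodd : ∫ θ in -(π / 2)..π / 2, |cos θ| ^ p * sin (2 * k * θ) = 0 := by
    have := intervalIntegral.integral_comp_neg (a := -(π / 2)) (b := π / 2)
      (fun θ : ℝ => |cos θ| ^ p * sin (2 * k * θ))
    simp only [cos_neg, mul_neg, sin_neg, intervalIntegral.integral_neg, neg_neg] at this
    linarith
  have hsplit (θ : ℝ) : g θ = |cos θ| ^ p * cos (2 * k * θ) * cos (2 * k * (t - φ)) -
      |cos θ| ^ p * sin (2 * k * θ) * sin (2 * k * (t - φ)) := by
    have : 2 * k * (θ + t - φ) = 2 * k * θ + 2 * k * (t - φ) := by ring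
    simp only [hg, this, cos_add]
    ring
  have hc := continuous_abs_cos_rpow hp
  rw [h1]
  simp_rw [hsplit]
  rw [intervalIntegral.integral_sub, intervalIntegral.integral_mul_const,
    intervalIntegral.integral_mul_const, hodd, zero_mul, sub_zero, cosPowCoeff]
  · exact ((hc.mul (by fun_prop)).mul continuous_const).intervalIntegrable _ _
  · exact ((hc.mul (by fun_prop)).mul continuous_const).intervalIntegrable _ _

theorem integral_cos_even_mul_sub_eq_zero {k : ℕ} (hk : k ≠ 0) (φ : ℝ) :
    ∫ θ in -(π / 2)..π / 2, cos (2 * k * (θ - φ)) = 0 := by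
  have hk' : (2 * k : ℝ) ≠ 0 := by positivity
  have hd : ∀ θ ∈ Set.uIcc (-(π / 2)) (π / 2),
      HasDerivAt (fun θ : ℝ => sin (2 * k * (θ - φ)) / (2 * k)) (cos (2 * k * (θ - φ))) θ := by
    intro θ _
    have := ((((hasDerivAt_id θ).sub_const φ).const_mul (2 * k : ℝ)).sin).div_const (2 * k : ℝ)
    refine this.congr_deriv ?_
    simp only [id]
    field_simp
  rw [intervalIntegral.integral_eq_sub_of_hasDerivAt hd
    (Continuous.intervalIntegrable (by fun_prop) _ _)]
  have : 2 * k * (π / 2 - φ) = 2 * k * (-(π / 2) - φ) + k * (2 * π) := by ring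
  rw [this, sin_add_nat_mul_two_pi, sub_self]

/-- If a superposition of translates of `|cos|^p` is constant, then the measure `∑ j, c j • δ (t j)`
has no Fourier coefficients at nonzero even frequencies. -/
theorem hasSum_mul_cos_eq_zero {p : ℝ} (hp : 0 < p) (hp' : ∀ k : ℕ, p ≠ 2 * (k : ℝ))
    {c t : ℕ → ℝ} (hc : ∀ j, 0 ≤ c j) (hs : Summable c)
    (h : ∀ θ, HasSum (fun j => c j * |cos (θ - t j)| ^ p) 1) {k : ℕ} (hk : k ≠ 0) (φ : ℝ) :
    HasSum (fun j => c j * cos (2 * k * (t j - φ))) 0 := by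
  have hcos (x : ℝ) : |cos x| ^ p ≤ 1 := rpow_le_one (abs_nonneg _) (abs_cos_le_one x) hp.le
  have key := intervalIntegral.hasSum_integral_of_dominated_convergence (μ := volume)
    (a := -(π / 2)) (b := π / 2)
    (F := fun j θ => c j * (|cos (θ - t j)| ^ p * cos (2 * k * (θ - φ))))
    (f := fun θ => cos (2 * k * (θ - φ))) (fun j _ => c j)
    (fun j => ((((continuous_abs_cos_rpow hp).comp (continuous_id.sub continuous_const)).mul
      (by fun_prop)).const_mul (c j)).aestronglyMeasurable)
    (fun j => Filter.Eventually.of_forall fun θ _ => by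
      rw [norm_mul, norm_mul, norm_of_nonneg (hc j), norm_of_nonneg (by positivity), norm_eq_abs]
      exact mul_le_of_le_one_right (hc j)
        (mul_le_one₀ (hcos _) (abs_nonneg _) (abs_cos_le_one _)))
    (Filter.Eventually.of_forall fun θ _ => hs)
    intervalIntegrable_const
    (Filter.Eventually.of_forall fun θ _ => by
      simpa only [mul_assoc, one_mul] using (h θ).mul_right (cos (2 * k * (θ - φ))))
  simp only [intervalIntegral.integral_const_mul, integral_abs_cos_sub_rpow_mul_cos hp,
    integral_cos_even_mul_sub_eq_zero hk] at key
  have hJ := cosPowCoeff_ne_zero hp hp' k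
  simpa only [mul_left_comm (c _), inv_mul_cancel_left₀ hJ, mul_zero] using
    key.mul_left (cosPowCoeff p k)⁻¹

/-- A finite atomic measure whose Fourier coefficients at nonzero even frequencies vanish is zero:
integrating the kernel `(∑ m < N, cos 2m(t - φ))² + (∑ m < N, sin 2m(t - φ))²` gives `N` times the
total mass, while an atom at `φ` contributes `N²` times its weight. -/
theorem eq_zero_of_hasSum_mul_cos_eq_zero {c t : ℕ → ℝ} (hc : ∀ j, 0 ≤ c j) (hs : Summable c)
    (h : ∀ k : ℕ, k ≠ 0 → ∀ φ, HasSum (fun j => c j * cos (2 * k * (t j - φ))) 0) (i : ℕ) :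
    c i = 0 := by
  set C := ∑' j, c j
  have hbound (N : ℕ) : N * c i * N ≤ C * N := by
    have hpair (m l : ℕ) : HasSum (fun j => c j * cos (2 * m * (t j - t i) - 2 * l * (t j - t i)))
        (if m = l then C else 0) := by
      obtain hml | rfl | hml := lt_trichotomy m l
      · rw [if_neg hml.ne]
        convert h (l - m) (by omega) (t i) using 3 with j
        rw [← cos_neg, Nat.cast_sub hml.le]
        ring_nf
      · simpa using hs.hasSum
      · rw [if_neg hml.ne']
        convert h (m - l) (by omega) (t i) using 3 with j
        rw [Nat.cast_sub hml.le]
        ring_nf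
    have hsum := hasSum_sum (s := Finset.range N) fun m _ =>
      hasSum_sum (s := Finset.range N) fun l _ => hpair m l
    have hker (j : ℕ) : ∑ m ∈ Finset.range N, ∑ l ∈ Finset.range N,
        c j * cos (2 * m * (t j - t i) - 2 * l * (t j - t i)) =
        c j * ((∑ m ∈ Finset.range N, cos (2 * m * (t j - t i))) ^ 2 +
          (∑ m ∈ Finset.range N, sin (2 * m * (t j - t i))) ^ 2) := by
      rw [sq, sq, Finset.sum_mul_sum, Finset.sum_mul_sum, ← Finset.sum_add_distrib, Finset.mul_sum]
      refine Finset.sum_congr rfl fun m _ => ?_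
      simp only [cos_sub, ← Finset.sum_add_distrib, Finset.mul_sum]
    simp only [hker] at hsum
    have hle := le_hasSum hsum i fun j _ => mul_nonneg (hc j) (by positivity)
    simp only [sub_self, mul_zero, cos_zero, sin_zero, Finset.sum_const, Finset.card_range,
      Finset.sum_ite_eq, Finset.mem_range, nsmul_eq_mul, mul_one] at hle
    rw [Finset.sum_congr rfl fun m hm => if_pos (Finset.mem_range.1 hm)] at hle
    simp only [Finset.sum_const, Finset.card_range, nsmul_eq_mul] at hle
    linarith
  refine le_antisymm ?_ (hc i)
  by_contra! hpos
  obtain ⟨N, hN⟩ := exists_nat_gt (C / c i)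
  rw [div_lt_iff₀ hpos] at hN
  have hC : 0 ≤ C := tsum_nonneg hc
  have hN0 : (0 : ℝ) < N := by
    by_contra! h0
    nlinarith
  nlinarith [hbound N]

theorem proposition1 (p : ℝ) (hp : 0 < p) (hp_not_even : ∀ k : ℕ, p ≠ 2 * (k : ℝ)) :
    ¬ ∃ (X : Submodule ℝ (lp (fun _ : ℕ => ℝ) (ENNReal.ofReal p)))
        (e : EuclideanSpace ℝ (Fin 2) ≃ₗ[ℝ] X),
        ∀ u : EuclideanSpace ℝ (Fin 2),
          ‖(e u : lp (fun _ : ℕ => ℝ) (ENNReal.ofReal p))‖ = ‖u‖ := by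
  rintro ⟨X, e, he⟩
  have hpr : (ENNReal.ofReal p).toReal = p := ENNReal.toReal_ofReal hp.le
  have hpr' : 0 < (ENNReal.ofReal p).toReal := by rwa [hpr]
  set a : lp (fun _ : ℕ => ℝ) (ENNReal.ofReal p) := (e !₂[1, 0]).1
  set b : lp (fun _ : ℕ => ℝ) (ENNReal.ofReal p) := (e !₂[0, 1]).1
  set z : ℕ → ℂ := fun j => ⟨a j, b j⟩ with hz
  have hcomb (θ : ℝ) : (e !₂[cos θ, sin θ]).1 =
      cos θ • a + sin θ • b := by
    have : !₂[cos θ, sin θ] = cos θ • !₂[(1 : ℝ), 0] + sin θ • !₂[(0 : ℝ), 1] := by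
      ext i; fin_cases i <;> simp
    rw [this, map_add, map_smul, map_smul]
    rfl
  have hcoord (θ : ℝ) (j : ℕ) : (cos θ • a + sin θ • b) j = ‖z j‖ * cos (θ - (z j).arg) := by
    have h1 : ‖z j‖ * cos (z j).arg = a j := Complex.norm_mul_cos_arg (z j)
    have h2 : ‖z j‖ * sin (z j).arg = b j := Complex.norm_mul_sin_arg (z j)
    have h3 : (cos θ • a + sin θ • b) j = cos θ * a j + sin θ * b j := rfl
    rw [h3, ← h1, ← h2, cos_sub]
    ring
  have hsum (θ : ℝ) : HasSum (fun j => ‖z j‖ ^ p * |cos (θ - (z j).arg)| ^ p) 1 := by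
    have h := lp.hasSum_norm hpr' (e !₂[cos θ, sin θ]).1
    have hn : ‖!₂[cos θ, sin θ]‖ = 1 := by
      simp [EuclideanSpace.norm_eq]
    rw [he, hn, one_rpow, hcomb, hpr] at h
    convert h using 2 with j
    rw [hcoord, norm_mul, norm_norm, norm_eq_abs, mul_rpow (norm_nonneg _) (abs_nonneg _)]
  have hs : Summable fun j => ‖z j‖ ^ p := by
    have h (x : lp (fun _ : ℕ => ℝ) (ENNReal.ofReal p)) : Summable fun j => ‖x j‖ ^ p := by
      simpa only [hpr] using (lp.hasSum_norm hpr' x).summable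
    refine Summable.of_nonneg_of_le (fun j => by positivity) (fun j => ?_)
      (((h a).add (h b)).mul_left (2 ^ p))
    have hle : ‖z j‖ ≤ 2 * max ‖a j‖ ‖b j‖ := by
      have := Complex.norm_le_abs_re_add_abs_im (z j)
      have h1 := le_max_left ‖a j‖ ‖b j‖
      have h2 := le_max_right ‖a j‖ ‖b j‖
      simp only [hz, norm_eq_abs] at *
      linarith
    calc ‖z j‖ ^ p ≤ (2 * max ‖a j‖ ‖b j‖) ^ p := rpow_le_rpow (norm_nonneg _) hle hp.le
      _ = 2 ^ p * max ‖a j‖ ‖b j‖ ^ p := mul_rpow (by norm_num) (by positivity)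
      _ ≤ 2 ^ p * (‖a j‖ ^ p + ‖b j‖ ^ p) := by
        gcongr
        have h1 : 0 ≤ ‖a j‖ ^ p := by positivity
        have h2 : 0 ≤ ‖b j‖ ^ p := by positivity
        rcases max_cases ‖a j‖ ‖b j‖ with h | h <;> rw [h.1] <;> linarith
  have hzero := eq_zero_of_hasSum_mul_cos_eq_zero (fun j => by positivity) hs
    fun k hk φ => hasSum_mul_cos_eq_zero hp hp_not_even (fun j => by positivity) hs hsum hk φ
  have h0 := hsum 0
  simp only [hzero, zero_mul] at h0
  exact zero_ne_one (hasSum_zero.unique h0)
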